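/- Let $d\ge 1$. For $u\in L^1(\mathbb R^d)$ let $\|Du\|(\mathbb R^d)=\sup\{\int u\,\operatorname{div}v : v\in C^1_c(\mathbb R^d;\mathbb R^d),\ |v|\le 1\}$. Let $BV([0,1]^d)$ be the space of (classes of) functions $u\in L^1(\mathbb R^d)$ with $u=0$ a.e. outside $[0,1]^d$ and $\|Du\|(\mathbb R^d)<\infty$, normed by $\|u\|_{BV}=\|u\|_1+\|Du\|(\mathbb R^d)$. For $f\in L^d([0,1]^d)$ let $T_f\in BV([0,1]^d)^*$ be $T_f(u)=\int_{[0,1]^d}fu$, and let $SCH([0,1]^d)$ be the closure of $\{T_f : f\in L^d([0,1]^d)\}$ in $BV([0,1]^d)^*$, with the dual norm. For each $n\ge 0$ let $K_{n,k}$, $0\le k\le 2^{nd}-1$, be the dyadic cubes $\prod_{i=1}^d[2^{-n}k_i,2^{-n}(k_i+1)]\subset[0,1]^d$ ($k_i$ integers), each listed once, numbered so that $K_{n+1,2^dk},\dots,K_{n+1,2^dk+2^d-1}$ are the $2^d$ subcubes of $K_{n,k}$ of side $2^{-(n+1)}$, for all $n$ and $k$. Let $A_1=\begin{pmatrix}1&1\\1&-1\end{pmatrix}$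 and $A_{m+1}=\begin{pmatrix}A_m&A_m\\A_m&-A_m\end{pmatrix}$, with the rows and columns of $A_d$ numbered from $0$ to $2^d-1$, and for $n\ge 0$, $0\le k\le 2^{nd}-1$, $1\le r\le 2^d-1$ let $$g_{n,k,r}=2^{nd/2}\sum_{\ell=0}^{2^d-1}(A_d)_{r,\ell}\,\mathbf 1_{K_{n+1,2^dk+\ell}}.$$ Proposition. There is a constant $C>0$, depending only on $d$, such that for every numbering of the dyadic cubes as above, all $n\ge 0$ and all real scalars $(a_{k,r})_{0\le k\le 2^{nd}-1,\ 1\le r\le 2^d-1}$, $$\frac{1}{2^{n(d/2+1)}C}\max_{1\le r\le 2^d-1}\sum_{k=0}^{2^{nd}-1}|a_{k,r}| \;\le\;\Bigl\|\sum_{k=0}^{2^{nd}-1}\sum_{r=1}^{2^d-1}a_{k,r}T_{g_{n,k,r}}\Bigr\|_{SCH([0,1]^d)} \;\le\; C\,2^{n(d/2-1)}\max_{k,r}|a_{k,r}|.$$ -/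

import Mathlib

noncomputable section

namespace StrongCharge

open MeasureTheory Set
open scoped ENNReal

/-- `ℝᵈ` with its Euclidean norm. -/
abbrev E (d : ℕ) : Type := EuclideanSpace ℝ (Fin d)

/-- The unit cube `[0,1]ᵈ`. -/
def unitCube (d : ℕ) : Set (E d) := {x | ∀ i, x i ∈ Icc (0 : ℝ) 1}

/-! ### Functions of bounded variation -/

/-- The divergence `∑ᵢ ∂ᵢ vᵢ` of a vector field. -/
def divergence {d : ℕ} (v : E d → E d) (x : E d) : ℝ :=
  ∑ i, (fderiv ℝ v x (EuclideanSpace.single i 1)) i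

/-- Admissible test fields: compactly supported `C¹` fields on `ℝᵈ` with `|v| ≤ 1`. -/
def testFields (d : ℕ) : Set (E d → E d) :=
  {v | ContDiff ℝ 1 v ∧ HasCompactSupport v ∧ ∀ x, ‖v x‖ ≤ 1}

/-- The total variation `‖Du‖(ℝᵈ) = sup_v ∫ u div v` of an integrable function. Since `-v` is
admissible whenever `v` is, truncating negative values to `0` does not change the supremum. -/
def variation {d : ℕ} (u : E d → ℝ) : ℝ≥0∞ :=
  ⨆ v ∈ testFields d, ENNReal.ofReal (∫ x, u x * divergence v x)

theorem continuous_divergence {d : ℕ} {v : E d → E d} (hv : v ∈ testFields d) :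
    Continuous (divergence v) := by
  have h := hv.1.continuous_fderiv (by norm_num)
  unfold divergence
  fun_prop

theorem divergence_bdd {d : ℕ} {v : E d → E d} (hv : v ∈ testFields d) :
    ∃ C, ∀ x, ‖divergence v x‖ ≤ C := by
  refine (continuous_divergence hv).bounded_above_of_compact_support ?_
  refine (hv.2.1.fderiv (𝕜 := ℝ)).mono ?_
  intro x hx
  contrapose! hx
  simp only [Function.mem_support, not_not] at hx ⊢
  simp [divergence, hx]

theorem integrable_mul_divergence {d : ℕ} {u : E d → ℝ} (hu : Integrable u)
    {v : E d → E d} (hv : v ∈ testFields d) :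
    Integrable (fun x => u x * divergence v x) := by
  obtain ⟨C, hC⟩ := divergence_bdd hv
  exact hu.mul_bdd (c := C) (continuous_divergence hv).aestronglyMeasurable
    (Filter.Eventually.of_forall hC)

theorem neg_mem_testFields {d : ℕ} {v : E d → E d} (hv : v ∈ testFields d) :
    -v ∈ testFields d :=
  ⟨hv.1.neg, hv.2.1.neg, fun x => by simpa using hv.2.2 x⟩

theorem divergence_neg {d : ℕ} (v : E d → E d) (x : E d) :
    divergence (-v) x = -divergence v x := by
  simp [divergence, fderiv_neg]

theorem variation_congr {d : ℕ} {u w : E d → ℝ} (h : u =ᵐ[volume] w) :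
    variation u = variation w := by
  unfold variation
  refine iSup_congr fun v => iSup_congr fun _ => ?_
  congr 1
  refine integral_congr_ae ?_
  filter_upwards [h] with x hx
  rw [hx]

theorem variation_add_le {d : ℕ} {u w : E d → ℝ} (hu : Integrable u) (hw : Integrable w) :
    variation (u + w) ≤ variation u + variation w := by
  refine iSup₂_le fun v hv => ?_
  have h : ∫ x, (u + w) x * divergence v x
      = (∫ x, u x * divergence v x) + ∫ x, w x * divergence v x := by
    rw [← integral_add (integrable_mul_divergence hu hv) (integrable_mul_divergence hw hv)]
    simp only [Pi.add_apply, add_mul]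
  rw [h]
  refine ENNReal.ofReal_add_le.trans (add_le_add ?_ ?_)
  · exact le_iSup₂ (f := fun v (_ : v ∈ testFields d) =>
      ENNReal.ofReal (∫ x, u x * divergence v x)) v hv
  · exact le_iSup₂ (f := fun v (_ : v ∈ testFields d) =>
      ENNReal.ofReal (∫ x, w x * divergence v x)) v hv

theorem variation_smul_le {d : ℕ} (c : ℝ) (u : E d → ℝ) :
    variation (c • u) ≤ ENNReal.ofReal |c| * variation u := by
  refine iSup₂_le fun v hv => ?_
  have h : ∫ x, (c • u) x * divergence v x = c * ∫ x, u x * divergence v x := by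
    rw [← integral_const_mul]
    simp only [Pi.smul_apply, smul_eq_mul, mul_assoc]
  rw [h]
  rcases le_total 0 c with hc | hc
  · rw [ENNReal.ofReal_mul hc, abs_of_nonneg hc]
    gcongr
    exact le_iSup₂ (f := fun v (_ : v ∈ testFields d) =>
      ENNReal.ofReal (∫ x, u x * divergence v x)) v hv
  · have h2 : c * ∫ x, u x * divergence v x
        = (-c) * ∫ x, u x * divergence (-v) x := by
      simp only [divergence_neg, mul_neg, integral_neg]
      ring
    rw [h2, ENNReal.ofReal_mul (by linarith), abs_of_nonpos hc]
    gcongr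
    exact le_iSup₂ (f := fun v (_ : v ∈ testFields d) =>
      ENNReal.ofReal (∫ x, u x * divergence v x)) (-v) (neg_mem_testFields hv)

theorem variation_zero {d : ℕ} : variation (0 : E d → ℝ) = 0 := by
  simp [variation]

theorem variation_smul {d : ℕ} (c : ℝ) (u : E d → ℝ) :
    variation (c • u) = ENNReal.ofReal |c| * variation u := by
  refine le_antisymm (variation_smul_le c u) ?_
  rcases eq_or_ne c 0 with rfl | hc
  · simp
  · have h := variation_smul_le c⁻¹ (c • u)
    rw [inv_smul_smul₀ hc] at h
    calc ENNReal.ofReal |c| * variation u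
        ≤ ENNReal.ofReal |c| * (ENNReal.ofReal |c⁻¹| * variation (c • u)) := by gcongr
      _ = variation (c • u) := by
        rw [← mul_assoc, ← ENNReal.ofReal_mul (abs_nonneg c), ← abs_mul,
          mul_inv_cancel₀ hc, abs_one, ENNReal.ofReal_one, one_mul]

theorem integrable_L1 {d : ℕ} (u : Lp ℝ 1 (volume : Measure (E d))) : Integrable u :=
  L1.integrable_coeFn u

/-- The classes in `L¹(ℝᵈ)` that vanish a.e. outside `[0,1]ᵈ` and have finite variation
over `ℝᵈ`. -/
def bvSubmodule (d : ℕ) : Submodule ℝ (Lp ℝ 1 (volume : Measure (E d))) where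
  carrier := {u | (∀ᵐ x, x ∉ unitCube d → u x = 0) ∧ variation u < ∞}
  zero_mem' := by
    have h := Lp.coeFn_zero ℝ 1 (volume : Measure (E d))
    refine ⟨?_, ?_⟩
    · filter_upwards [h] with x hx _
      rw [hx, Pi.zero_apply]
    · rw [variation_congr h, variation_zero]
      exact ENNReal.zero_lt_top
  add_mem' := by
    rintro u w ⟨hu, hu'⟩ ⟨hw, hw'⟩
    have h := Lp.coeFn_add u w
    refine ⟨?_, ?_⟩
    · filter_upwards [h, hu, hw] with x hx h1 h2 hx'
      rw [hx, Pi.add_apply, h1 hx', h2 hx', add_zero]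
    · rw [variation_congr h]
      exact (variation_add_le (integrable_L1 u) (integrable_L1 w)).trans_lt
        (ENNReal.add_lt_top.2 ⟨hu', hw'⟩)
  smul_mem' := by
    rintro c u ⟨hu, hu'⟩
    have h := Lp.coeFn_smul c u
    refine ⟨?_, ?_⟩
    · filter_upwards [h, hu] with x hx h1 hx'
      rw [hx, Pi.smul_apply, h1 hx', smul_zero]
    · rw [variation_congr h, variation_smul]
      exact ENNReal.mul_lt_top ENNReal.ofReal_lt_top hu'

/-- The space `BV([0,1]ᵈ)`. A type synonym of `bvSubmodule d`, so that it does not carry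
the `L¹` norm. -/
def BV (d : ℕ) : Type := bvSubmodule d

instance (d : ℕ) : AddCommGroup (BV d) := inferInstanceAs (AddCommGroup (bvSubmodule d))

instance (d : ℕ) : Module ℝ (BV d) := inferInstanceAs (Module ℝ (bvSubmodule d))

/-- The class in `L¹(ℝᵈ)` of a function of bounded variation. -/
def BV.toL1 {d : ℕ} : BV d →ₗ[ℝ] Lp ℝ 1 (volume : Measure (E d)) := (bvSubmodule d).subtype

/-- The norm `‖u‖_BV = ‖u‖₁ + ‖Du‖(ℝᵈ)`. -/
instance (d : ℕ) : Norm (BV d) := ⟨fun u => ‖u.toL1‖ + (variation u.toL1).toReal⟩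

theorem BV.norm_def {d : ℕ} (u : BV d) : ‖u‖ = ‖u.toL1‖ + (variation u.toL1).toReal := rfl

theorem BV.variation_lt_top {d : ℕ} (u : BV d) : variation u.toL1 < ∞ := u.2.2

theorem BV.core (d : ℕ) : NormedSpace.Core ℝ (BV d) where
  norm_nonneg u := by rw [BV.norm_def]; positivity
  norm_smul c u := by
    rw [BV.norm_def, BV.norm_def, map_smul, norm_smul, variation_congr (Lp.coeFn_smul c u.toL1),
      variation_smul, ENNReal.toReal_mul, ENNReal.toReal_ofReal (abs_nonneg c), Real.norm_eq_abs]
    ring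
  norm_triangle u w := by
    rw [BV.norm_def, BV.norm_def, BV.norm_def, map_add, variation_congr (Lp.coeFn_add _ _)]
    have h1 := norm_add_le u.toL1 w.toL1
    have h2 := ENNReal.toReal_mono
      (ENNReal.add_lt_top.2 ⟨u.variation_lt_top, w.variation_lt_top⟩).ne
      (variation_add_le (integrable_L1 u.toL1) (integrable_L1 w.toL1))
    rw [ENNReal.toReal_add u.variation_lt_top.ne w.variation_lt_top.ne] at h2
    linarith
  norm_eq_zero_iff u := by
    constructor
    · intro h
      rw [BV.norm_def] at h
      have h1 : ‖u.toL1‖ = 0 := by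
        have := norm_nonneg u.toL1
        have : 0 ≤ (variation u.toL1).toReal := ENNReal.toReal_nonneg
        linarith
      exact Subtype.ext (norm_eq_zero.1 h1)
    · rintro rfl
      rw [BV.norm_def, map_zero, variation_congr (Lp.coeFn_zero ℝ 1 _), variation_zero]
      simp

instance (d : ℕ) : NormedAddCommGroup (BV d) := NormedAddCommGroup.ofCore (BV.core d)

instance (d : ℕ) : NormedSpace ℝ (BV d) := NormedSpace.ofCore (BV.core d)

/-! ### Strong charge functionals -/

/-- The functional `α` on `BV([0,1]ᵈ)` is `T_f : u ↦ ∫_{[0,1]ᵈ} f u`. -/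
def IsT {d : ℕ} (f : E d → ℝ) (α : StrongDual ℝ (BV d)) : Prop :=
  ∀ u : BV d, IntegrableOn (fun x => f x * u.toL1 x) (unitCube d) ∧
    α u = ∫ x in unitCube d, f x * u.toL1 x

/-- The range of `T : Lᵈ([0,1]ᵈ) → BV([0,1]ᵈ)*`. -/
def rangeT (d : ℕ) : Submodule ℝ (StrongDual ℝ (BV d)) where
  carrier := {α | ∃ f : E d → ℝ, MemLp f d (volume.restrict (unitCube d)) ∧ IsT f α}
  zero_mem' := ⟨0, MemLp.zero, fun u => by simp⟩
  add_mem' := by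
    rintro α β ⟨f, hf, hα⟩ ⟨g, hg, hβ⟩
    refine ⟨f + g, hf.add hg, fun u => ⟨?_, ?_⟩⟩
    · have h := (hα u).1.add (hβ u).1
      refine h.congr (Filter.Eventually.of_forall fun x => ?_)
      simp only [Pi.add_apply, add_mul]
    · rw [add_apply, (hα u).2, (hβ u).2,
        ← integral_add (hα u).1 (hβ u).1]
      simp only [Pi.add_apply, add_mul]
  smul_mem' := by
    rintro c α ⟨f, hf, hα⟩
    refine ⟨c • f, hf.const_smul c, fun u => ⟨?_, ?_⟩⟩
    · have h := (hα u).1.const_mul c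
      refine h.congr (Filter.Eventually.of_forall fun x => ?_)
      simp only [Pi.smul_apply, smul_eq_mul, mul_assoc]
    · rw [smul_apply, (hα u).2, smul_eq_mul, ← integral_const_mul]
      simp only [Pi.smul_apply, smul_eq_mul, mul_assoc]

/-- The space `SCH([0,1]ᵈ)` of strong charge functionals: the closure of the range of `T` in
`BV([0,1]ᵈ)*`, with the norm of `BV([0,1]ᵈ)*`. -/
abbrev SCH (d : ℕ) : Submodule ℝ (StrongDual ℝ (BV d)) := (rangeT d).topologicalClosure

theorem integrableOn_mul {d : ℕ} {f : E d → ℝ}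
    (hf : MemLp f ∞ (volume.restrict (unitCube d))) (u : BV d) :
    IntegrableOn (fun x => f x * u.toL1 x) (unitCube d) :=
  hf.integrable_mul ((memLp_one_iff_integrable).2 (integrable_L1 u.toL1).integrableOn)

/-- `T_f` as a continuous functional, for bounded `f`. -/
def boundedT {d : ℕ} (f : E d → ℝ) (hf : MemLp f ∞ (volume.restrict (unitCube d))) :
    StrongDual ℝ (BV d) :=
  LinearMap.mkContinuous
    { toFun := fun u => ∫ x in unitCube d, f x * u.toL1 x
      map_add' := fun u w => by
        rw [← integral_add (integrableOn_mul hf u) (integrableOn_mul hf w)]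
        refine integral_congr_ae ?_
        filter_upwards [ae_restrict_of_ae (Lp.coeFn_add u.toL1 w.toL1)] with x hx
        rw [map_add, hx, Pi.add_apply, mul_add]
      map_smul' := fun c u => by
        rw [RingHom.id_apply, smul_eq_mul, ← integral_const_mul]
        refine integral_congr_ae ?_
        filter_upwards [ae_restrict_of_ae (Lp.coeFn_smul c u.toL1)] with x hx
        rw [map_smul, hx, Pi.smul_apply, smul_eq_mul]
        ring }
    (eLpNorm f ∞ (volume.restrict (unitCube d))).toReal
    (fun u => by
      set M := (eLpNorm f ∞ (volume.restrict (unitCube d))).toReal with hM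
      have hb : ∀ᵐ x ∂(volume.restrict (unitCube d)), ‖f x‖ ≤ M := by
        have h := ae_le_eLpNormEssSup (f := f) (μ := volume.restrict (unitCube d))
        filter_upwards [h] with x hx
        rw [hM, eLpNorm_exponent_top, ← toReal_enorm]
        exact ENNReal.toReal_mono (by simpa using hf.2.ne) hx
      have hu := (integrable_L1 u.toL1)
      calc ‖∫ x in unitCube d, f x * u.toL1 x‖
          ≤ ∫ x in unitCube d, M * ‖u.toL1 x‖ := by
            refine norm_integral_le_of_norm_le (hu.norm.integrableOn.const_mul M) ?_
            filter_upwards [hb] with x hx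
            rw [norm_mul]
            gcongr
        _ = M * ∫ x in unitCube d, ‖u.toL1 x‖ := integral_const_mul _ _
        _ ≤ M * ‖u.toL1‖ := by
            rw [L1.norm_eq_integral_norm]
            gcongr
            · exact Filter.Eventually.of_forall fun x => norm_nonneg _
            · exact hu.norm
            · exact Measure.restrict_le_self
        _ ≤ M * ‖u‖ := by
            rw [BV.norm_def]
            gcongr
            have : 0 ≤ (variation u.toL1).toReal := ENNReal.toReal_nonneg
            linarith)

theorem volume_unitCube_lt_top (d : ℕ) : volume (unitCube d) < ∞ := by
  refine (Bornology.IsBounded.measure_lt_top ?_)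
  refine isBounded_iff_forall_norm_le.2 ⟨√d, fun x hx => ?_⟩
  rw [EuclideanSpace.norm_eq]
  refine Real.sqrt_le_sqrt ?_
  calc ∑ i, ‖x i‖ ^ 2 ≤ ∑ _i : Fin d, (1 : ℝ) := by
        refine Finset.sum_le_sum fun i _ => ?_
        have h := hx i
        rw [Real.norm_eq_abs, sq_abs]
        nlinarith [h.1, h.2]
    _ = d := by simp

theorem boundedT_mem {d : ℕ} (f : E d → ℝ) (hf : MemLp f ∞ (volume.restrict (unitCube d))) :
    boundedT f hf ∈ SCH d := by
  have : IsFiniteMeasure (volume.restrict (unitCube d)) :=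
    ⟨by simpa using volume_unitCube_lt_top d⟩
  exact Submodule.le_topologicalClosure _
    ⟨f, hf.mono_exponent le_top, fun u => ⟨integrableOn_mul hf u, rfl⟩⟩

/-- The strong charge functional `T_f`, for bounded `f`. -/
def T {d : ℕ} (f : E d → ℝ) (hf : MemLp f ∞ (volume.restrict (unitCube d))) : SCH d :=
  ⟨boundedT f hf, boundedT_mem f hf⟩

/-! ### Dyadic cubes and Haar functions -/

/-- The dyadic cubes `∏ᵢ [2⁻ⁿ kᵢ, 2⁻ⁿ (kᵢ + 1)]`, `0 ≤ kᵢ ≤ 2ⁿ - 1`, of generation `n`. -/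
def dyadicCubes (d n : ℕ) : Set (Set (E d)) :=
  {Q | ∃ m : Fin d → ℕ, (∀ i, m i < 2 ^ n) ∧
    Q = {x | ∀ i, x i ∈ Icc ((m i : ℝ) / 2 ^ n) (((m i : ℝ) + 1) / 2 ^ n)}}

/-- The index `2ᵈ k + ℓ`. -/
def childIndex {d n : ℕ} (k : Fin (2 ^ (n * d))) (l : Fin (2 ^ d)) : Fin (2 ^ ((n + 1) * d)) :=
  ⟨2 ^ d * k + l, by
    have hk := k.2
    have hl := l.2
    calc 2 ^ d * (k : ℕ) + l < 2 ^ d * k + 2 ^ d := by omega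
      _ = 2 ^ d * (k + 1) := by ring
      _ ≤ 2 ^ d * 2 ^ (n * d) := Nat.mul_le_mul_left _ hk
      _ = 2 ^ ((n + 1) * d) := by ring⟩

/-- An admissible numbering `K_{n,k}` of the dyadic cubes: for each `n`, the cubes `K_{n,k}`,
`0 ≤ k < 2^{nd}`, are all the dyadic cubes of generation `n`, without repetition, and the
`K_{n+1,2ᵈk+ℓ}`, `0 ≤ ℓ < 2ᵈ`, are the dyadic subcubes of generation `n + 1` of `K_{n,k}`. -/
structure DyadicNumbering (d : ℕ) where
  cube : ∀ n : ℕ, Fin (2 ^ (n * d)) ≃ dyadicCubes d n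
  children : ∀ (n : ℕ) (k : Fin (2 ^ (n * d))),
    range (fun l : Fin (2 ^ d) => (cube (n + 1) (childIndex k l) : Set (E d))) =
      {Q | Q ∈ dyadicCubes d (n + 1) ∧ Q ⊆ cube n k}

/-- The matrix `A_d` of order `2ᵈ`: `A_{d+1}` is the block matrix with rows `(A_d, A_d)` and
`(A_d, -A_d)`, starting from the one by one matrix `1`. -/
def haarMatrix : (d : ℕ) → Matrix (Fin (2 ^ d)) (Fin (2 ^ d)) ℝ
  | 0 => fun _ _ => 1
  | d + 1 =>
    let e : Fin (2 ^ (d + 1)) ≃ Fin (2 ^ d) ⊕ Fin (2 ^ d) :=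
      (finCongr (by ring)).trans finSumFinEquiv.symm
    (Matrix.fromBlocks (haarMatrix d) (haarMatrix d) (haarMatrix d) (-haarMatrix d)).submatrix e e

/-- The type numbers `r ∈ {1, …, 2ᵈ - 1}`. -/
abbrev TypeNumber (d : ℕ) : Type := {r : Fin (2 ^ d) // r ≠ 0}

/-- The Haar function `g_{n,k,r} = 2^{nd/2} ∑_ℓ (A_d)_{r,ℓ} 1_{K_{n+1,2ᵈk+ℓ}}`. -/
def haar {d : ℕ} (K : DyadicNumbering d) (n : ℕ) (k : Fin (2 ^ (n * d))) (r : TypeNumber d) :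
    E d → ℝ := fun x =>
  (2 : ℝ) ^ ((n : ℝ) * d / 2) * ∑ l : Fin (2 ^ d), haarMatrix d r l *
    indicator (K.cube (n + 1) (childIndex k l) : Set (E d)) (fun _ => (1 : ℝ)) x

theorem measurableSet_dyadicCube {d n : ℕ} (Q : dyadicCubes d n) :
    MeasurableSet (Q : Set (E d)) := by
  obtain ⟨Q, m, hm, rfl⟩ := Q
  simp only [Set.ofPred_forall]
  exact MeasurableSet.iInter fun i =>
    measurableSet_Icc.preimage (by fun_prop)

theorem memLp_haar {d : ℕ} (K : DyadicNumbering d) (n : ℕ) (k : Fin (2 ^ (n * d)))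
    (r : TypeNumber d) : MemLp (haar K n k r) ∞ (volume.restrict (unitCube d)) := by
  have h : ∀ l : Fin (2 ^ d), MemLp (fun x => haarMatrix d r l *
      indicator (K.cube (n + 1) (childIndex k l) : Set (E d)) (fun _ => (1 : ℝ)) x) ∞
      (volume.restrict (unitCube d)) := fun l =>
    ((memLp_top_const (1 : ℝ)).indicator (measurableSet_dyadicCube _)).const_mul _
  exact (memLp_finsetSum Finset.univ fun l _ => h l).const_mul _

/-- The strong charge functional `T_{g_{n,k,r}}`. -/
def haarCharge {d : ℕ} (K : DyadicNumbering d) (n : ℕ) (k : Fin (2 ^ (n * d)))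
    (r : TypeNumber d) : SCH d := T (haar K n k r) (memLp_haar K n k r)

end StrongCharge

end

noncomputable section

namespace StrongCharge

open MeasureTheory Set Filter Topology
open scoped ENNReal Convolution

/-! ### The translation estimate -/

/-! On `u` the charge takes the value `2^(nd/2) ∑ₖ ∑ₗ c k l * ∫ u` over the subcubes, with `c k l =
∑ᵣ a k r * A r l` (`sum_haarCharge_apply`). Both bounds rest on the orthogonality of the rows of the
sign matrix `A`.

Upper bound: the rows `r ≠ 0` are orthogonal to row `0`, which is all ones, so `∑ₗ c k l = 0` and
each integral may be replaced by its difference from the integral over the sibling `l = 0`. Siblings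
are translates of each other by a vector of length `O(2⁻ⁿ)`. Since `∫_B |u(x + h) - u(x)| ≤ ‖h‖
‖Du‖` for bounded measurable `B` and the cubes are almost disjoint, the differences add up to `O(2⁻ⁿ
‖Du‖)` (`sum_abs_setIntegral_sub_le`).

Lower bound: by duality, the charge is tested on `u = ∑ 2^(nd/2) sign(a k r) A r l 1_Q`, `r` fixed
and `Q` running over the subcubes. Orthogonality gives exactly `∑ₖ |a k r|`, while the triangle
inequality and the perimeter of a cube give `‖u‖ = O(2^(nd/2) 2ⁿ)`
(`sum_abs_le_norm_sum_haarCharge`). -/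

theorem abs_integral_mul_divergence_le {d : ℕ} {u : E d → ℝ} (hu' : variation u < ∞)
    {v : E d → E d} (hv : ContDiff ℝ 1 v)
    (hc : HasCompactSupport v) {M : ℝ} (hM : 0 ≤ M) (hvM : ∀ x, ‖v x‖ ≤ M) :
    |∫ x, u x * divergence v x| ≤ M * (variation u).toReal := by
  have key : ∀ w ∈ testFields d, ∫ x, u x * divergence w x ≤ (variation u).toReal := by
    intro w hw
    refine (ENNReal.ofReal_le_iff_le_toReal hu'.ne).1 ?_
    exact le_iSup₂ (f := fun v (_ : v ∈ testFields d) =>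
      ENNReal.ofReal (∫ x, u x * divergence v x)) w hw
  rcases hM.eq_or_lt with rfl | hM
  · have : v = 0 := funext fun x => norm_le_zero_iff.1 (hvM x)
    simp [this, divergence]
  have hw : M⁻¹ • v ∈ testFields d := by
    refine ⟨hv.const_smul M⁻¹, hc.smul_left (f := fun _ => M⁻¹), fun x => ?_⟩
    rw [Pi.smul_apply, norm_smul, norm_inv, Real.norm_eq_abs, abs_of_pos hM]
    rw [inv_mul_le_iff₀ hM, mul_one]
    exact hvM x
  have hdiv : ∀ x, divergence v x = M * divergence (M⁻¹ • v) x := by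
    intro x
    have hd : DifferentiableAt ℝ v x := hv.differentiable (by norm_num) x
    simp only [divergence, fderiv_const_smul hd]
    simp only [FunLike.coe_smul, Pi.smul_apply, PiLp.smul_apply, smul_eq_mul]
    rw [← Finset.mul_sum, mul_inv_cancel_left₀ hM.ne']
  have hI : ∫ x, u x * divergence v x = M * ∫ x, u x * divergence (M⁻¹ • v) x := by
    rw [← integral_const_mul]
    refine integral_congr_ae (Eventually.of_forall fun x => ?_)
    simp only [hdiv x]
    ring
  rw [hI, abs_mul, abs_of_pos hM]
  refine mul_le_mul_of_nonneg_left (abs_le.2 ⟨?_, key _ hw⟩) hM.le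
  have := key _ (neg_mem_testFields hw)
  simp only [divergence_neg, mul_neg, integral_neg] at this
  linarith

/-- Turns the derivative of a test function along a translation into a divergence, which the
variation can control. -/
theorem divergence_smul_const {d : ℕ} {f : E d → ℝ} {x : E d} (hf : DifferentiableAt ℝ f x)
    (h : E d) : divergence (fun y => f y • h) x = fderiv ℝ f x h := by
  have h1 : fderiv ℝ (fun y => f y • h) x = (fderiv ℝ f x).smulRight h := by
    rw [fderiv_smul_const hf]
  have h2 : h = ∑ i, h i • EuclideanSpace.single i (1 : ℝ) := by
    ext j
    simp [Finset.sum_apply, Pi.single_apply]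
  simp only [divergence, h1]
  conv_rhs => rw [h2, map_sum]
  refine Finset.sum_congr rfl fun i _ => ?_
  simp [mul_comm]

/-- Mean value inequality for `t ↦ ∫ u(x) ψ(x - t h)` on `[0,1]`: its derivative pairs `u` with the
divergence of a field of length at most `‖h‖`. -/
theorem abs_integral_translate_le {d : ℕ} {u : E d → ℝ} (hu : Integrable u)
    (hu' : variation u < ∞) {ψ : E d → ℝ} (hψ : ContDiff ℝ 1 ψ) (hc : HasCompactSupport ψ)
    (h1 : ∀ x, |ψ x| ≤ 1) (h : E d) :
    |(∫ x, u x * ψ (x - h)) - ∫ x, u x * ψ x| ≤ ‖h‖ * (variation u).toReal := by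
  obtain ⟨C, hC⟩ := (hψ.continuous_fderiv (by norm_num)).bounded_above_of_compact_support
    (hc.fderiv (𝕜 := ℝ))
  have hdiff : Differentiable ℝ ψ := hψ.differentiable (by norm_num)
  have hsub : ∀ t : ℝ, ∀ x : E d, HasFDerivAt (fun y : E d => ψ (y - t • h))
      (fderiv ℝ ψ (x - t • h)) x := fun t x => by
    have := (hdiff (x - t • h)).hasFDerivAt.comp x ((hasFDerivAt_id x).sub_const (t • h))
    rw [ContinuousLinearMap.comp_id] at this
    exact this
  -- Differentiation under the integral sign; `|u| C ‖h‖`, with `C` a bound for the derivative of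
  -- `ψ`, dominates for all `t` at once.
  have hder : ∀ t : ℝ, HasDerivAt (fun t : ℝ => ∫ x, u x * ψ (x - t • h))
      (∫ x, u x * (-fderiv ℝ ψ (x - t • h) h)) t := by
    intro t
    refine (hasDerivAt_integral_of_dominated_loc_of_deriv_le (s := univ)
      (F := fun t x => u x * ψ (x - t • h))
      (F' := fun t x => u x * (-fderiv ℝ ψ (x - t • h) h))
      (bound := fun x => |u x| * (C * ‖h‖)) univ_mem ?_ ?_ ?_ ?_ ?_ ?_).2
    · refine Eventually.of_forall fun s => hu.aestronglyMeasurable.mul ?_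
      exact (hψ.continuous.comp (by fun_prop)).aestronglyMeasurable
    · refine hu.mul_bdd (c := 1) ?_ (Eventually.of_forall fun x => h1 _)
      exact (hψ.continuous.comp (by fun_prop)).aestronglyMeasurable
    · refine hu.aestronglyMeasurable.mul ?_
      have := hψ.continuous_fderiv (by norm_num)
      exact (Continuous.neg ((this.comp (by fun_prop)).clm_apply
        continuous_const)).aestronglyMeasurable
    · refine Eventually.of_forall fun x s _ => ?_
      rw [norm_mul, norm_neg, Real.norm_eq_abs]
      gcongr
      exact (ContinuousLinearMap.le_opNorm _ _).trans (by gcongr; exact hC _)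
    · exact hu.abs.mul_const _
    · refine Eventually.of_forall fun x s _ => HasDerivAt.const_mul _ ?_
      have hl : HasDerivAt (fun s : ℝ => x - s • h) (-h) s := by
        simpa using ((hasDerivAt_id s).smul_const h).const_sub x
      have := (hdiff (x - s • h)).hasFDerivAt.comp_hasDerivAt s hl
      rw [map_neg] at this
      exact this
  have hbound : ∀ t : ℝ, ‖∫ x, u x * (-fderiv ℝ ψ (x - t • h) h)‖ ≤
      ‖h‖ * (variation u).toReal := by
    intro t
    have hdv : ∀ x, -fderiv ℝ ψ (x - t • h) h =
        divergence (fun y => ψ (y - t • h) • (-h)) x := by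
      intro x
      rw [divergence_smul_const (hsub t x).differentiableAt, (hsub t x).fderiv, map_neg]
    simp only [hdv]
    refine abs_integral_mul_divergence_le hu' ?_ ?_ (norm_nonneg h) ?_
    · exact (hψ.comp (contDiff_id.sub contDiff_const)).smul contDiff_const
    · have : HasCompactSupport (fun y : E d => ψ (y - t • h)) := by
        simpa [sub_eq_add_neg, Function.comp_def] using
          hc.comp_homeomorph (Homeomorph.addRight (-(t • h)))
      exact this.smul_right
    · intro x
      rw [norm_smul, norm_neg]
      exact mul_le_of_le_one_left (norm_nonneg h) (h1 _)
  have := Convex.norm_image_sub_le_of_norm_hasDerivWithin_le (s := (univ : Set ℝ))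
    (fun t _ => (hder t).hasDerivWithinAt) (fun t _ => hbound t) convex_univ
    (mem_univ 0) (mem_univ 1)
  simpa using this

/-- Mollification: averaging against a probability density preserves the bound `1`, and Lebesgue
differentiation gives convergence almost everywhere. -/
theorem exists_seq_contDiff_tendsto {d : ℕ} {ψ : E d → ℝ} (hm : Integrable ψ)
    (hc : HasCompactSupport ψ) (h1 : ∀ x, |ψ x| ≤ 1) :
    ∃ f : ℕ → E d → ℝ, (∀ j, ContDiff ℝ 1 (f j) ∧ HasCompactSupport (f j) ∧
      ∀ x, |f j x| ≤ 1) ∧ ∀ᵐ x, Tendsto (fun j => f j x) atTop (𝓝 (ψ x)) := by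
  -- The ratio of outer to inner radius stays equal to `2`; a bounded ratio is what convergence
  -- almost everywhere requires for a merely integrable `ψ`.
  let φ : ℕ → ContDiffBump (0 : E d) := fun j =>
    ⟨1 / ((j : ℝ) + 1), 2 / ((j : ℝ) + 1), by positivity, by gcongr; norm_num⟩
  refine ⟨fun j => ((φ j).normed volume ⋆[ContinuousLinearMap.lsmul ℝ ℝ, volume] ψ),
    fun j => ⟨?_, ?_, ?_⟩, ?_⟩
  · exact (φ j).hasCompactSupport_normed.contDiff_convolution_left _
      (φ j).contDiff_normed hm.locallyIntegrable
  · exact (φ j).hasCompactSupport_normed.convolution _ hc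
  · intro x
    beta_reduce
    rw [convolution_def]
    calc |∫ t, (φ j).normed volume t * ψ (x - t)|
        ≤ ∫ t, (φ j).normed volume t := by
          have hφi : Integrable ((φ j).normed (volume : Measure (E d))) :=
            (φ j).integrable_normed
          rw [← Real.norm_eq_abs]
          refine norm_integral_le_of_norm_le hφi (Eventually.of_forall fun t => ?_)
          rw [norm_mul, Real.norm_eq_abs,
            abs_of_nonneg ((φ j).nonneg_normed (μ := volume) t)]
          exact mul_le_of_le_one_right ((φ j).nonneg_normed t) (h1 _)
      _ = 1 := (φ j).integral_normed
  · refine ContDiffBump.ae_convolution_tendsto_right_of_locallyIntegrable (K := 2) ?_ ?_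
      hm.locallyIntegrable
    · exact tendsto_const_div_atTop_nhds_zero_nat 2 |>.comp (tendsto_add_atTop_nat 1) |>.congr
        fun j => by simp [φ]
    · refine Eventually.of_forall fun j => le_of_eq ?_
      simp only [φ]
      ring

/-- Translating a function of bounded variation by `h` moves it by at most `‖h‖ ‖Du‖` in `L¹`. -/
theorem setIntegral_abs_translate_sub_le {d : ℕ} {u : E d → ℝ} (hu : Integrable u)
    (hu' : variation u < ∞) (h : E d) {B : Set (E d)} (hB : MeasurableSet B)
    (hB' : Bornology.IsBounded B) :
    ∫ x in B, |u (x + h) - u x| ≤ ‖h‖ * (variation u).toReal := by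
  have huh : Integrable fun x => u (x + h) := hu.comp_add_right h
  set w : E d → ℝ := fun x => u (x + h) - u x with hw
  have hwi : Integrable w := huh.sub hu
  -- `ψ` is the sign of `w` on `B`, so that `∫ w ψ = ∫_B |w|`. The measurable representative `w'`
  -- makes it measurable, and boundedness of `B` gives it compact support.
  obtain ⟨w', hw'm, hw'⟩ := hwi.aestronglyMeasurable.aemeasurable
  set ψ : E d → ℝ := B.indicator fun x => if 0 ≤ w' x then 1 else -1 with hψ
  have hψ1 : ∀ x, |ψ x| ≤ 1 := by
    intro x
    by_cases hx : x ∈ B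
    · simp only [hψ, indicator_of_mem hx]
      split_ifs <;> simp
    · simp [hψ, indicator_of_notMem hx]
  have hψm : Measurable ψ :=
    (Measurable.ite (measurableSet_le measurable_const hw'm) measurable_const
      measurable_const).indicator hB
  have hψc : HasCompactSupport ψ := by
    refine HasCompactSupport.of_support_subset_isCompact hB'.isCompact_closure ?_
    exact (support_indicator_subset).trans subset_closure
  have hψi : Integrable ψ := by
    refine Integrable.mono' (g := B.indicator fun _ => (1 : ℝ)) ?_ hψm.aestronglyMeasurable ?_
    · exact (integrable_indicator_iff hB).2 (integrableOn_const hB'.measure_lt_top.ne)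
    · refine Eventually.of_forall fun x => ?_
      by_cases hx : x ∈ B
      · simpa [indicator_of_mem hx] using hψ1 x
      · simp [hψ, indicator_of_notMem hx]
  obtain ⟨f, hf, hlim⟩ := exists_seq_contDiff_tendsto hψi hψc hψ1
  have hval : ∫ x in B, |w x| = ∫ x, w x * ψ x := by
    rw [← integral_indicator hB]
    refine integral_congr_ae ?_
    filter_upwards [hw'] with x hx
    by_cases hxB : x ∈ B
    · simp only [hψ, indicator_of_mem hxB, hx]
      split_ifs with h0
      · rw [abs_of_nonneg h0, mul_one]
      · rw [abs_of_neg (not_le.1 h0)]; ring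
    · simp [hψ, indicator_of_notMem hxB]
  have htend : Tendsto (fun j => ∫ x, w x * f j x) atTop (𝓝 (∫ x, w x * ψ x)) := by
    refine tendsto_integral_of_dominated_convergence (fun x => |w x|) ?_ hwi.abs ?_ ?_
    · exact fun j => hwi.aestronglyMeasurable.mul (hf j).1.continuous.aestronglyMeasurable
    · refine fun j => Eventually.of_forall fun x => ?_
      rw [norm_mul]
      exact mul_le_of_le_one_right (norm_nonneg _) ((hf j).2.2 x)
    · filter_upwards [hlim] with x hx using hx.const_mul _
  rw [hval]
  refine le_of_tendsto htend (Eventually.of_forall fun j => ?_)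
  obtain ⟨hf1, hf2, hf3⟩ := hf j
  have hi1 : Integrable fun x => u (x + h) * f j x :=
    huh.mul_bdd (c := 1) hf1.continuous.aestronglyMeasurable (Eventually.of_forall hf3)
  have hi2 : Integrable fun x => u x * f j x :=
    hu.mul_bdd (c := 1) hf1.continuous.aestronglyMeasurable (Eventually.of_forall hf3)
  -- A change of variables moves the translation from `u` to the smooth function.
  have heq : ∫ x, w x * f j x = (∫ x, u x * f j (x - h)) - ∫ x, u x * f j x := by
    simp only [hw, sub_mul]
    rw [integral_sub hi1 hi2,
      ← integral_add_right_eq_self (fun x => u x * f j (x - h)) h]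
    simp
  rw [heq]
  exact (le_abs_self _).trans (abs_integral_translate_le hu hu' hf1 hf2 hf3 h)

/-! ### Boxes and dyadic cubes -/

/-- The box `∏ᵢ [aᵢ, bᵢ]`. -/
def box {d : ℕ} (a b : Fin d → ℝ) : Set (E d) := {x | ∀ i, x i ∈ Icc (a i) (b i)}

theorem box_eq_preimage {d : ℕ} (a b : Fin d → ℝ) :
    box a b = (WithLp.ofLp : E d → Fin d → ℝ) ⁻¹' Icc a b := by
  ext x
  simp only [box, mem_ofPred_eq, mem_preimage, mem_Icc, Pi.le_def]
  exact forall_and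

theorem measurableSet_box {d : ℕ} (a b : Fin d → ℝ) : MeasurableSet (box a b) := by
  rw [box_eq_preimage]
  exact measurableSet_Icc.preimage (PiLp.volume_preserving_ofLp (Fin d)).measurable

theorem box_inter {d : ℕ} (a b a' b' : Fin d → ℝ) :
    box a b ∩ box a' b' = box (a ⊔ a') (b ⊓ b') := by
  simp only [box_eq_preimage, ← preimage_inter, Icc_inter_Icc]

theorem volume_box {d : ℕ} (a b : Fin d → ℝ) :
    volume (box a b) = ∏ i, ENNReal.ofReal (b i - a i) := by
  rw [box_eq_preimage, (PiLp.volume_preserving_ofLp (Fin d)).measure_preimage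
    measurableSet_Icc.nullMeasurableSet, Real.volume_Icc_pi]

theorem volume_box_lt_top {d : ℕ} (a b : Fin d → ℝ) : volume (box a b) < ∞ := by
  rw [volume_box]
  exact ENNReal.prod_lt_top fun i _ => ENNReal.ofReal_lt_top

theorem setIntegral_box {d : ℕ} (a b : Fin d → ℝ) (f : E d → ℝ) :
    ∫ x in box a b, f x = ∫ y in Icc a b, f (WithLp.toLp 2 y) := by
  have h := (PiLp.volume_preserving_toLp (Fin d)).setIntegral_preimage_emb
    (MeasurableEquiv.toLp 2 (Fin d → ℝ)).measurableEmbedding f (box a b)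
  rw [← h, box_eq_preimage]
  rfl

theorem abs_setIntegral_le {n : ℕ} {a b : Fin n → ℝ} {s : ℝ} (hs : 0 ≤ s)
    (hab : ∀ i, b i - a i = s) {f : (Fin n → ℝ) → ℝ} (hf : ∀ y, |f y| ≤ 1) :
    |∫ y in Icc a b, f y| ≤ s ^ n := by
  have hv : volume.real (Icc a b) = s ^ n := by
    rw [measureReal_def, Real.volume_Icc_pi_toReal fun i => by linarith [hab i]]
    simp [hab]
  have := norm_setIntegral_le_of_norm_le_const (μ := volume) (s := Icc a b) (C := 1) (f := f)
    isCompact_Icc.measure_lt_top fun x _ => hf x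
  rwa [hv, one_mul] at this

/-- By the divergence theorem, the integral of `div v` is the flux through `2(n + 1)` faces, each of
area `s ^ n`, where the components of `v` are at most `1` in absolute value. -/
theorem variation_indicator_box_le {n : ℕ} {a b : Fin (n + 1) → ℝ} {s : ℝ} (hs : 0 ≤ s)
    (hab : ∀ i, b i - a i = s) :
    variation ((box a b).indicator fun _ => (1 : ℝ)) ≤
      ENNReal.ofReal (2 * (n + 1) * s ^ n) := by
  refine iSup₂_le fun v hv => ENNReal.ofReal_le_ofReal ?_
  have h1 : ∫ x, (box a b).indicator (fun _ => (1 : ℝ)) x * divergence v x =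
      ∫ x in box a b, divergence v x := by
    rw [← integral_indicator (measurableSet_box a b)]
    congr 1 with x
    by_cases hx : x ∈ box a b <;> simp [hx]
  rw [h1, setIntegral_box]
  let L : (Fin (n + 1) → ℝ) →L[ℝ] E (n + 1) :=
    (PiLp.continuousLinearEquiv 2 ℝ (fun _ : Fin (n + 1) => ℝ)).symm
  have hL : ∀ y, L y = WithLp.toLp 2 y := fun y => rfl
  have hdiv : ∀ y, divergence v (WithLp.toLp 2 y) =
      ∑ i, ((EuclideanSpace.proj i).comp ((fderiv ℝ v (L y)).comp L)) (Pi.single i 1) := by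
    intro y
    rfl
  have hcont : Continuous v := hv.1.continuous
  have key := integral_divergence_of_hasFDerivAt_off_countable' a b
    (fun i => by linarith [hab i])
    (fun i y => v (L y) i) (fun i y => (EuclideanSpace.proj i).comp ((fderiv ℝ v (L y)).comp L))
    ∅ countable_empty (fun i => by fun_prop) (fun y _ i => ?_) ?_
  · simp only [hdiv]
    rw [key]
    have hc : ∀ (i : Fin (n + 1)) (z : E (n + 1)), |v z i| ≤ 1 := fun i z =>
      (PiLp.norm_apply_le (v z) i).trans (hv.2.2 z)
    calc _ ≤ ∑ _i : Fin (n + 1), 2 * s ^ n := by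
          refine Finset.sum_le_sum fun i _ => ?_
          refine (le_abs_self _).trans ((abs_sub _ _).trans ?_)
          rw [two_mul]
          exact add_le_add (abs_setIntegral_le hs (fun j => hab _) fun y => hc _ _)
            (abs_setIntegral_le hs (fun j => hab _) fun y => hc _ _)
      _ = 2 * (n + 1) * s ^ n := by simp; ring
  · have hd : HasFDerivAt v (fderiv ℝ v (L y)) (L y) :=
      (hv.1.differentiable (by norm_num) _).hasFDerivAt
    exact (EuclideanSpace.proj i : E (n + 1) →L[ℝ] ℝ).hasFDerivAt.comp y
      (hd.comp y L.hasFDerivAt)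
  · refine ContinuousOn.integrableOn_compact isCompact_Icc (Continuous.continuousOn ?_)
    simp only [← hdiv]
    exact (continuous_divergence hv).comp L.continuous

/-- The dyadic cube of generation `n` with lower corner `2⁻ⁿ m`. -/
def dyadicBox {d : ℕ} (n : ℕ) (m : Fin d → ℕ) : Set (E d) :=
  box (fun i => (m i : ℝ) / 2 ^ n) (fun i => ((m i : ℝ) + 1) / 2 ^ n)

theorem measurableSet_dyadicBox {d n : ℕ} (m : Fin d → ℕ) :
    MeasurableSet (dyadicBox n m) := measurableSet_box _ _

theorem dyadicBox_side {n : ℕ} (m : ℕ) :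
    ((m : ℝ) + 1) / 2 ^ n - (m : ℝ) / 2 ^ n = (2 ^ n)⁻¹ := by ring

theorem measureReal_dyadicBox {d n : ℕ} (m : Fin d → ℕ) :
    volume.real (dyadicBox n m) = ((2 : ℝ) ^ n)⁻¹ ^ d := by
  have h : (0 : ℝ) ≤ (2 ^ n)⁻¹ := by positivity
  simp only [measureReal_def, dyadicBox, volume_box, dyadicBox_side, ENNReal.toReal_prod,
    ENNReal.toReal_ofReal h]
  simp

/-- Closed dyadic cubes may share faces, so disjointness holds only up to null sets: in a coordinate
where the corners differ, the intersection has no width. -/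
theorem volume_dyadicBox_inter {d n : ℕ} {m m' : Fin d → ℕ} (h : m ≠ m') :
    volume (dyadicBox n m ∩ dyadicBox n m') = 0 := by
  obtain ⟨i, hi⟩ := Function.ne_iff.1 h
  rw [dyadicBox, dyadicBox, box_inter, volume_box]
  refine Finset.prod_eq_zero (Finset.mem_univ i) (ENNReal.ofReal_of_nonpos ?_)
  simp only [Pi.sup_apply, Pi.inf_apply, sub_nonpos]
  rcases lt_or_gt_of_ne hi with h | h
  · have : (m i : ℝ) + 1 ≤ m' i := by exact_mod_cast h
    exact (inf_le_left.trans (by gcongr)).trans le_sup_right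
  · have : (m' i : ℝ) + 1 ≤ m i := by exact_mod_cast h
    exact (inf_le_right.trans (by gcongr)).trans le_sup_left

theorem dyadicBox_subset_unitCube {d n : ℕ} {m : Fin d → ℕ} (hm : ∀ i, m i < 2 ^ n) :
    dyadicBox n m ⊆ unitCube d := by
  intro x hx i
  have h2 : (m i : ℝ) + 1 ≤ 2 ^ n := by exact_mod_cast hm i
  exact ⟨le_trans (by positivity) (hx i).1,
    (hx i).2.trans ((div_le_one (by positivity)).2 h2)⟩

/-- A subcube of the next generation has its lower corner at `2m` or `2m + 1`, coordinatewise. -/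
theorem of_dyadicBox_subset {d n : ℕ} {m M : Fin d → ℕ}
    (h : dyadicBox (n + 1) m ⊆ dyadicBox n M) (i : Fin d) : 2 * M i ≤ m i ∧ m i ≤ 2 * M i + 1 := by
  have hp : (0 : ℝ) < 2 ^ n := by positivity
  have hp' : (0 : ℝ) < 2 ^ (n + 1) := by positivity
  -- The lowest and the highest corner of the subcube carry all the information.
  have hlow := h (show WithLp.toLp 2 (fun i => (m i : ℝ) / 2 ^ (n + 1)) ∈ _ from
    fun i => ⟨le_rfl, by dsimp only; gcongr; linarith⟩) i
  have hup := h (show WithLp.toLp 2 (fun i => ((m i : ℝ) + 1) / 2 ^ (n + 1)) ∈ _ from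
    fun i => ⟨by dsimp only; gcongr; linarith, le_rfl⟩) i
  have h1 := hlow.1
  have h2 := hup.2
  dsimp only at h1 h2
  rw [div_le_div_iff₀ hp hp', pow_succ] at h1
  rw [div_le_div_iff₀ hp' hp, pow_succ] at h2
  have h1' : (2 : ℝ) * M i ≤ m i := by
    refine le_of_mul_le_mul_right ?_ hp; linarith
  have h2' : (m i : ℝ) + 1 ≤ 2 * M i + 2 := by
    refine le_of_mul_le_mul_right ?_ hp; linarith
  norm_cast at h1' h2'
  omega

theorem setIntegral_dyadicBox_translate {d n : ℕ} {m m' : Fin d → ℕ} {h : E d}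
    (hh : ∀ i, h i = ((m' i : ℝ) - m i) / 2 ^ n) (f : E d → ℝ) :
    ∫ x in dyadicBox n m', f x = ∫ x in dyadicBox n m, f (x + h) := by
  have := (measurePreserving_add_right (volume : Measure (E d)) h).setIntegral_preimage_emb
    (measurableEmbedding_addRight h) f (dyadicBox n m')
  rw [← this]
  congr 2
  ext x
  simp only [dyadicBox, box, mem_preimage, mem_ofPred_eq, PiLp.add_apply, hh, mem_Icc]
  refine forall_congr' fun i => ?_
  simp only [sub_div, add_div]
  constructor <;> rintro ⟨h1, h2⟩ <;> constructor <;> linarith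

/-! ### The sign matrices -/

/-- The splitting of the indices of `haarMatrix (d + 1)` into two halves. -/
def halves (d : ℕ) : Fin (2 ^ (d + 1)) ≃ Fin (2 ^ d) ⊕ Fin (2 ^ d) :=
  (finCongr (by ring)).trans finSumFinEquiv.symm

theorem haarMatrix_succ (d : ℕ) : haarMatrix (d + 1) =
    (Matrix.fromBlocks (haarMatrix d) (haarMatrix d) (haarMatrix d)
      (-haarMatrix d)).submatrix (halves d) (halves d) := rfl

theorem halves_zero (d : ℕ) : halves d 0 = Sum.inl 0 := by
  rw [← Equiv.eq_symm_apply]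
  ext
  simp [halves]

theorem haarMatrix_zero_left (d : ℕ) (l : Fin (2 ^ d)) : haarMatrix d 0 l = 1 := by
  induction d with
  | zero => rfl
  | succ d ih =>
    rw [haarMatrix_succ, Matrix.submatrix_apply, halves_zero]
    rcases halves d l with l | l <;> simp [ih]

theorem abs_haarMatrix_le (d : ℕ) (r l : Fin (2 ^ d)) : |haarMatrix d r l| ≤ 1 := by
  induction d with
  | zero => simp [haarMatrix]
  | succ d ih =>
    rw [haarMatrix_succ, Matrix.submatrix_apply]
    rcases halves d l with l | l <;> rcases halves d r with r | r <;> simp [ih]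

/-- In the block product the two contributions to a diagonal block add up, giving the factor `2`,
and those to an off-diagonal block cancel. -/
theorem haarMatrix_mul_transpose (d : ℕ) :
    haarMatrix d * (haarMatrix d).transpose = (2 : ℝ) ^ d • (1 : Matrix _ _ ℝ) := by
  induction d with
  | zero =>
    ext i j
    have : Subsingleton (Fin (2 ^ 0)) := inferInstanceAs (Subsingleton (Fin 1))
    rw [Matrix.mul_apply, Subsingleton.elim i j]
    simp only [Matrix.transpose_apply]
    simp [haarMatrix]
  | succ d ih =>
    rw [haarMatrix_succ, Matrix.transpose_submatrix, Matrix.submatrix_mul_equiv,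
      Matrix.fromBlocks_transpose, Matrix.fromBlocks_multiply, Matrix.transpose_neg,
      Matrix.neg_mul, Matrix.mul_neg, Matrix.mul_neg, Matrix.neg_mul, neg_neg, ih,
      add_neg_cancel, ← two_smul ℝ, smul_smul, ← pow_succ',
      ← Matrix.submatrix_one_equiv (halves d), ← Matrix.fromBlocks_one]
    ext i j
    simp only [Matrix.submatrix_apply, Matrix.smul_apply]
    rcases halves d i with i | i <;> rcases halves d j with j | j <;> simp

theorem sum_haarMatrix_mul {d : ℕ} (r r' : Fin (2 ^ d)) :
    ∑ l, haarMatrix d r l * haarMatrix d r' l = if r = r' then (2 : ℝ) ^ d else 0 := by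
  have := congrFun (congrFun (haarMatrix_mul_transpose d) r) r'
  simpa [Matrix.mul_apply, Matrix.one_apply] using this

/-! ### Haar charges as combinations of integrals over dyadic cubes -/

/-- The subcube `K_{n+1,2ᵈk+ℓ}` of `K_{n,k}`. -/
def child {d : ℕ} (K : DyadicNumbering d) {n : ℕ} (k : Fin (2 ^ (n * d))) (l : Fin (2 ^ d)) :
    Set (E d) := K.cube (n + 1) (childIndex k l)

theorem childIndex_inj {d n : ℕ} {k k' : Fin (2 ^ (n * d))} {l l' : Fin (2 ^ d)}
    (h : childIndex k l = childIndex k' l') : k = k' ∧ l = l' := by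
  have h1 : 2 ^ d * (k : ℕ) + l = 2 ^ d * k' + l' := congrArg Fin.val h
  have hp : 0 < 2 ^ d := by positivity
  have h2 := congrArg (· / 2 ^ d) h1
  have h3 := congrArg (· % 2 ^ d) h1
  simp only [Nat.mul_add_div hp, Nat.div_eq_of_lt l.2, Nat.div_eq_of_lt l'.2, add_zero] at h2
  simp only [Nat.mul_add_mod, Nat.mod_eq_of_lt l.2, Nat.mod_eq_of_lt l'.2] at h3
  exact ⟨Fin.ext h2, Fin.ext h3⟩

/-- Lower corners `2⁻⁽ⁿ⁺¹⁾ m` of the subcubes of generation `n + 1`. -/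
theorem exists_corners {d : ℕ} (K : DyadicNumbering d) (n : ℕ) :
    ∃ m : Fin (2 ^ (n * d)) → Fin (2 ^ d) → Fin d → ℕ,
      (∀ k l, child K k l = dyadicBox (n + 1) (m k l)) ∧
      (∀ k l i, m k l i < 2 ^ (n + 1)) ∧
      (∀ k l k' l', m k l = m k' l' → k = k' ∧ l = l') ∧
      ∀ k l l' i, m k l' i ≤ m k l i + 1 := by
  have hex : ∀ k l, ∃ m : Fin d → ℕ, (∀ i, m i < 2 ^ (n + 1)) ∧
      child K k l = dyadicBox (n + 1) m := fun k l => (K.cube (n + 1) (childIndex k l)).2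
  choose m hm1 hm2 using hex
  refine ⟨m, hm2, hm1, fun k l k' l' h => ?_, fun k l l' i => ?_⟩
  · refine childIndex_inj ((K.cube (n + 1)).injective (Subtype.ext ?_))
    change child K k l = child K k' l'
    rw [hm2, hm2, h]
  -- Siblings lie in one parent with corner `M`, so each coordinate of their corners is `2M` or `2M
  -- + 1`.
  · obtain ⟨M, -, hM⟩ := (K.cube n k).2
    have hsub : ∀ l, dyadicBox (n + 1) (m k l) ⊆ dyadicBox n M := by
      intro l
      have : child K k l ∈ {Q | Q ∈ dyadicCubes d (n + 1) ∧ Q ⊆ K.cube n k} := by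
        rw [← K.children n k]
        exact ⟨l, rfl⟩
      rw [← hm2]
      exact this.2.trans hM.subset
    have h1 := of_dyadicBox_subset (hsub l) i
    have h2 := of_dyadicBox_subset (hsub l') i
    omega

theorem haarCharge_apply {d : ℕ} (K : DyadicNumbering d) (n : ℕ) (k : Fin (2 ^ (n * d)))
    (r : TypeNumber d) (u : BV d) :
    (haarCharge K n k r : StrongDual ℝ (BV d)) u = (2 : ℝ) ^ ((n : ℝ) * d / 2) *
      ∑ l, haarMatrix d r l * ∫ x in child K k l, u.toL1 x := by
  obtain ⟨m, hm, hm', -⟩ := exists_corners K n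
  have hsub : ∀ l, child K k l ⊆ unitCube d := fun l => by
    rw [hm]; exact dyadicBox_subset_unitCube (hm' k l)
  have hms : ∀ l, MeasurableSet (child K k l) := fun l => measurableSet_dyadicCube _
  have hu := integrable_L1 u.toL1
  change ∫ x in unitCube d, haar K n k r x * u.toL1 x = _
  have hpt : ∀ x, haar K n k r x * u.toL1 x = (2 : ℝ) ^ ((n : ℝ) * d / 2) *
      ∑ l, haarMatrix d r l * (child K k l).indicator u.toL1 x := by
    intro x
    simp only [haar, mul_assoc, Finset.sum_mul]
    congr 1
    refine Finset.sum_congr rfl fun l _ => ?_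
    change haarMatrix d r l * ((child K k l).indicator (fun _ => (1 : ℝ)) x * u.toL1 x) = _
    by_cases hx : x ∈ child K k l <;> simp [hx]
  simp only [hpt]
  rw [integral_const_mul, integral_finsetSum _ fun l _ =>
    ((hu.indicator (hms l)).integrableOn.const_mul _)]
  congr 1
  refine Finset.sum_congr rfl fun l _ => ?_
  rw [integral_const_mul, setIntegral_indicator (hms l), inter_eq_right.2 (hsub l)]

theorem sum_haarCharge_apply {d : ℕ} (K : DyadicNumbering d) (n : ℕ)
    (a : Fin (2 ^ (n * d)) → TypeNumber d → ℝ) (u : BV d) :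
    (↑(∑ k, ∑ r, a k r • haarCharge K n k r) : StrongDual ℝ (BV d)) u =
      (2 : ℝ) ^ ((n : ℝ) * d / 2) * ∑ k, ∑ l, (∑ r, a k r * haarMatrix d r l) *
        ∫ x in child K k l, u.toL1 x := by
  simp only [Submodule.coe_sum, Submodule.coe_smul, sum_apply, smul_apply,
    haarCharge_apply, smul_eq_mul, Finset.mul_sum, Finset.sum_mul]
  refine Finset.sum_congr rfl fun k _ => ?_
  rw [Finset.sum_comm]
  refine Finset.sum_congr rfl fun l _ => Finset.sum_congr rfl fun r _ => ?_
  ring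

/-! ### The upper bound -/

theorem sum_setIntegral_dyadicBox_le {d n : ℕ} {κ : Type*} [Fintype κ] {m : κ → Fin d → ℕ}
    (hm : Function.Injective m) (hlt : ∀ k i, m k i < 2 ^ n) {w : E d → ℝ} (hw : Integrable w) :
    ∑ k, ∫ x in dyadicBox n (m k), |w x| ≤ ∫ x in unitCube d, |w x| := by
  have h := integral_iUnion_ae (μ := (volume : Measure (E d))) (f := fun x => |w x|)
    (s := fun k => dyadicBox n (m k)) (fun k => (measurableSet_dyadicBox _).nullMeasurableSet)
    (fun k k' hk => volume_dyadicBox_inter (hm.ne hk)) hw.abs.integrableOn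
  rw [tsum_fintype] at h
  rw [← h]
  refine setIntegral_mono_set hw.abs.integrableOn (Eventually.of_forall fun x => abs_nonneg _) ?_
  exact (iUnion_subset fun k => dyadicBox_subset_unitCube (hlt k)).eventuallyLE

theorem norm_le_of_coord_le {d : ℕ} {h : E d} {s : ℝ} (hh : ∀ i, |h i| ≤ s) :
    ‖h‖ ≤ d * s := by
  have h1 : h = ∑ i, EuclideanSpace.single i (h i) := by
    ext j
    simp [Finset.sum_apply, Pi.single_apply]
  rw [h1]
  refine (norm_sum_le _ _).trans ?_
  calc _ ≤ ∑ _i : Fin d, s := Finset.sum_le_sum fun i _ => by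
        rw [PiLp.norm_single]; exact hh i
    _ = d * s := by simp

theorem measurableSet_unitCube (d : ℕ) : MeasurableSet (unitCube d) := by
  have : unitCube d = box (fun _ => 0) (fun _ => 1) := rfl
  rw [this]
  exact measurableSet_box _ _

theorem isBounded_unitCube (d : ℕ) : Bornology.IsBounded (unitCube d) := by
  refine isBounded_iff_forall_norm_le.2 ⟨d * 1, fun x hx => ?_⟩
  exact norm_le_of_coord_le fun i => abs_le.2 ⟨by linarith [(hx i).1], (hx i).2⟩

/-- The integrals of `u` over two families of subcubes that are neighbours of each other differ
in total by at most the size of the cubes times `‖Du‖`. -/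
theorem sum_abs_setIntegral_sub_le {d n : ℕ} {κ : Type*} [Fintype κ] {m m' : κ → Fin d → ℕ}
    (hm : Function.Injective m) (hlt : ∀ k i, m k i < 2 ^ n)
    (h1 : ∀ k i, m' k i ≤ m k i + 1) (h2 : ∀ k i, m k i ≤ m' k i + 1)
    {u : E d → ℝ} (hu : Integrable u) (hu' : variation u < ∞) :
    ∑ k, |(∫ x in dyadicBox n (m' k), u x) - ∫ x in dyadicBox n (m k), u x| ≤
      3 ^ d * (d * (2 ^ n)⁻¹ * (variation u).toReal) := by
  -- The shift from `m k` to `m' k` depends on `k`, but it is one of `3 ^ d` vectors with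
  -- coordinates `-1, 0, 1` in units of `2⁻ⁿ`, coded by `0, 1, 2`. Summing over all of them allows
  -- one translation estimate per vector, uniformly in `k`.
  let h : (Fin d → Fin 3) → E d := fun e =>
    WithLp.toLp 2 fun i => (((e i : ℕ) : ℝ) - 1) / 2 ^ n
  have hnorm : ∀ e, ‖h e‖ ≤ d * (2 ^ n)⁻¹ := by
    refine fun e => norm_le_of_coord_le fun i => ?_
    change |(((e i : ℕ) : ℝ) - 1) / 2 ^ n| ≤ _
    rw [abs_div, abs_of_pos (by positivity : (0 : ℝ) < 2 ^ n), div_eq_mul_inv]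
    refine mul_le_of_le_one_left (by positivity) ?_
    have h3 : ((e i : ℕ) : ℝ) ≤ 2 := by exact_mod_cast Nat.le_of_lt_succ (e i).2
    have h4 : (0 : ℝ) ≤ (e i : ℕ) := Nat.cast_nonneg _
    exact abs_le.2 ⟨by linarith, by linarith⟩
  have hint : ∀ e, Integrable fun x => u (x + h e) - u x := fun e =>
    (hu.comp_add_right (h e)).sub hu
  have hterm : ∀ k, |(∫ x in dyadicBox n (m' k), u x) - ∫ x in dyadicBox n (m k), u x| ≤
      ∑ e, ∫ x in dyadicBox n (m k), |u (x + h e) - u x| := by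
    intro k
    let e : Fin d → Fin 3 := fun i => ⟨m' k i + 1 - m k i, by have := h1 k i; omega⟩
    have he : ∀ i, h e i = ((m' k i : ℝ) - m k i) / 2 ^ n := by
      intro i
      change (((m' k i + 1 - m k i : ℕ) : ℝ) - 1) / 2 ^ n = _
      rw [Nat.cast_sub (h2 k i)]
      push_cast
      ring
    rw [setIntegral_dyadicBox_translate he, ← integral_sub
      (hu.comp_add_right (h e)).integrableOn hu.integrableOn]
    refine abs_integral_le_integral_abs.trans ?_
    exact Finset.single_le_sum (f := fun e => ∫ x in dyadicBox n (m k), |u (x + h e) - u x|)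
      (fun e _ => integral_nonneg fun x => abs_nonneg _) (Finset.mem_univ e)
  calc _ ≤ ∑ k, ∑ e, ∫ x in dyadicBox n (m k), |u (x + h e) - u x| :=
        Finset.sum_le_sum fun k _ => hterm k
    _ = ∑ e, ∑ k, ∫ x in dyadicBox n (m k), |u (x + h e) - u x| := Finset.sum_comm
    _ ≤ ∑ _e : Fin d → Fin 3, d * (2 ^ n)⁻¹ * (variation u).toReal := by
        refine Finset.sum_le_sum fun e _ => ?_
        refine (sum_setIntegral_dyadicBox_le hm hlt (hint e)).trans ?_
        refine (setIntegral_abs_translate_sub_le hu hu' (h e) (measurableSet_unitCube d)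
          (isBounded_unitCube d)).trans ?_
        gcongr
        exact hnorm e
    _ = _ := by simp

/-- Rows with `r ≠ 0` are orthogonal to row `0`, which is constant: this is the vanishing mean of
the Haar functions. -/
theorem sum_coeff_eq_zero {d : ℕ} (a : TypeNumber d → ℝ) :
    ∑ l, ∑ r, a r * haarMatrix d r l = 0 := by
  rw [Finset.sum_comm]
  refine Finset.sum_eq_zero fun r _ => ?_
  have := sum_haarMatrix_mul (r : Fin (2 ^ d)) 0
  simp only [haarMatrix_zero_left, mul_one, if_neg r.2] at this
  rw [← Finset.mul_sum, this, mul_zero]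

theorem abs_coeff_le {d : ℕ} {a : TypeNumber d → ℝ} {M : ℝ} (hM : 0 ≤ M) (ha : ∀ r, |a r| ≤ M)
    (l : Fin (2 ^ d)) : |∑ r, a r * haarMatrix d r l| ≤ 2 ^ d * M := by
  calc |∑ r, a r * haarMatrix d r l| ≤ ∑ r, |a r * haarMatrix d r l| :=
        Finset.abs_sum_le_sum_abs _ _
    _ ≤ ∑ _r : TypeNumber d, M := Finset.sum_le_sum fun r _ => by
        rw [abs_mul]
        exact (mul_le_of_le_one_right (abs_nonneg _) (abs_haarMatrix_le d r l)).trans (ha r)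
    _ = Fintype.card (TypeNumber d) * M := by simp
    _ ≤ 2 ^ d * M := by
        gcongr
        have := Fintype.card_subtype_le fun r : Fin (2 ^ d) => r ≠ 0
        rw [Fintype.card_fin] at this
        exact_mod_cast this

theorem norm_sum_haarCharge_le {d : ℕ} (K : DyadicNumbering d) (n : ℕ)
    (a : Fin (2 ^ (n * d)) → TypeNumber d → ℝ) {M : ℝ} (hM : 0 ≤ M) (ha : ∀ k r, |a k r| ≤ M) :
    ‖∑ k, ∑ r, a k r • haarCharge K n k r‖ ≤
      12 ^ d * d * ((2 : ℝ) ^ ((n : ℝ) * d / 2) * (2 ^ n)⁻¹) * M := by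
  rw [← Submodule.norm_coe]
  refine ContinuousLinearMap.opNorm_le_bound _ (by positivity) fun u => ?_
  obtain ⟨m, hm, hlt, hinj, hnear⟩ := exists_corners K n
  rw [sum_haarCharge_apply]
  set P := (2 : ℝ) ^ ((n : ℝ) * d / 2) with hP
  have hP0 : 0 < P := by positivity
  set V := (variation u.toL1).toReal with hV
  have hV0 : 0 ≤ V := ENNReal.toReal_nonneg
  set I : Fin (2 ^ (n * d)) → Fin (2 ^ d) → ℝ := fun k l => ∫ x in child K k l, u.toL1 x with hI
  have hsum : ∀ l, ∑ k, |I k l - I k 0| ≤ 3 ^ d * (d * (2 ^ (n + 1))⁻¹ * V) := by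
    intro l
    simp only [hI, hm]
    exact sum_abs_setIntegral_sub_le (m := fun k => m k 0) (m' := fun k => m k l)
      (fun k k' h => (hinj _ _ _ _ h).1) (fun k => hlt k 0) (fun k => hnear k 0 l)
      (fun k => hnear k l 0) (integrable_L1 u.toL1) u.variation_lt_top
  have hrow : ∀ k, ∑ l, (∑ r, a k r * haarMatrix d r l) * I k l =
      ∑ l, (∑ r, a k r * haarMatrix d r l) * (I k l - I k 0) := by
    intro k
    simp only [mul_sub, Finset.sum_sub_distrib]
    rw [← Finset.sum_mul, sum_coeff_eq_zero, zero_mul, sub_zero]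
  rw [Finset.sum_congr rfl fun k _ => hrow k, norm_mul, Real.norm_eq_abs, Real.norm_eq_abs, abs_of_pos hP0]
  have hmain : |∑ k, ∑ l, (∑ r, a k r * haarMatrix d r l) * (I k l - I k 0)| ≤
      2 ^ d * (2 ^ d * M * (3 ^ d * (d * (2 ^ (n + 1))⁻¹ * V))) := by
    calc _ ≤ ∑ k, ∑ l, 2 ^ d * M * |I k l - I k 0| := by
          refine (Finset.abs_sum_le_sum_abs _ _).trans (Finset.sum_le_sum fun k _ => ?_)
          refine (Finset.abs_sum_le_sum_abs _ _).trans (Finset.sum_le_sum fun l _ => ?_)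
          rw [abs_mul]
          gcongr
          exact abs_coeff_le hM (ha k) l
      _ = ∑ l, 2 ^ d * M * ∑ k, |I k l - I k 0| := by
          rw [Finset.sum_comm]
          simp only [Finset.mul_sum]
      _ ≤ ∑ _l : Fin (2 ^ d), 2 ^ d * M * (3 ^ d * (d * (2 ^ (n + 1))⁻¹ * V)) := by
          refine Finset.sum_le_sum fun l _ => ?_
          gcongr
          exact hsum l
      _ = _ := by simp
  have hVu : V ≤ ‖u‖ := by
    rw [BV.norm_def]
    linarith [norm_nonneg u.toL1]
  -- One `2 ^ d` bounds the coefficients, the other counts the siblings, and `3 ^ d` counts the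
  -- shifts.
  have h12 : (12 : ℝ) ^ d = 2 ^ d * 2 ^ d * 3 ^ d := by
    rw [← mul_pow, ← mul_pow]; norm_num
  calc _ ≤ P * (2 ^ d * (2 ^ d * M * (3 ^ d * (d * (2 ^ (n + 1))⁻¹ * V)))) := by gcongr
    _ ≤ P * (2 ^ d * (2 ^ d * M * (3 ^ d * (d * (2 ^ n)⁻¹ * ‖u‖)))) := by
        gcongr
        · norm_num
        · omega
    _ = _ := by rw [h12]; ring

/-! ### The lower bound -/

/-- Building blocks of the test function for the lower bound; the norm estimate is volume plus
perimeter. -/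
theorem exists_indicator_dyadicBox {d n : ℕ} {m : Fin (d + 1) → ℕ} (hm : ∀ i, m i < 2 ^ n) :
    ∃ χ : BV (d + 1), χ.toL1 =ᵐ[volume] (dyadicBox n m).indicator (fun _ => (1 : ℝ)) ∧
      ‖χ‖ ≤ ((2 : ℝ) ^ n)⁻¹ ^ (d + 1) + 2 * (d + 1) * ((2 : ℝ) ^ n)⁻¹ ^ d := by
  have hms : MeasurableSet (dyadicBox n m) := measurableSet_dyadicBox m
  have hi : Integrable ((dyadicBox n m).indicator fun _ => (1 : ℝ)) :=
    (integrable_indicator_iff hms).2 (integrableOn_const (volume_box_lt_top _ _).ne)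
  have hae : Integrable.toL1 _ hi =ᵐ[volume] (dyadicBox n m).indicator (fun _ => (1 : ℝ)) :=
    Integrable.coeFn_toL1 hi
  have hvar : variation (Integrable.toL1 _ hi) ≤
      ENNReal.ofReal (2 * (d + 1) * ((2 : ℝ) ^ n)⁻¹ ^ d) := by
    rw [variation_congr hae]
    exact variation_indicator_box_le (by positivity) fun i => dyadicBox_side _
  let χ : BV (d + 1) := ⟨Integrable.toL1 _ hi, by
    refine ⟨?_, hvar.trans_lt ENNReal.ofReal_lt_top⟩
    filter_upwards [hae] with x hx hx'
    rw [hx, indicator_of_notMem fun h => hx' (dyadicBox_subset_unitCube hm h)]⟩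
  have hχ : χ.toL1 = Integrable.toL1 _ hi := rfl
  refine ⟨χ, hae, ?_⟩
  rw [BV.norm_def, hχ]
  refine add_le_add (le_of_eq ?_) (ENNReal.toReal_le_of_le_ofReal (by positivity) hvar)
  rw [L1.norm_eq_integral_norm, ← measureReal_dyadicBox m, ← integral_indicator_one hms]
  refine integral_congr_ae ?_
  filter_upwards [hae] with x hx
  rw [hx]
  by_cases hx : x ∈ dyadicBox n m <;> simp [hx]

/-- Row orthogonality inverts the passage from `a` to the coefficients on the subcubes. -/
theorem sum_haarMatrix_mul_coeff {d : ℕ} (a : TypeNumber d → ℝ) (r : TypeNumber d) :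
    ∑ l, haarMatrix d r l * ∑ r', a r' * haarMatrix d r' l = 2 ^ d * a r := by
  simp only [Finset.mul_sum]
  rw [Finset.sum_comm]
  have : ∀ r' : TypeNumber d, ∑ l, haarMatrix d r l * (a r' * haarMatrix d r' l) =
      if r = r' then 2 ^ d * a r' else 0 := by
    intro r'
    simp only [mul_left_comm _ (a r')]
    rw [← Finset.mul_sum, sum_haarMatrix_mul]
    simp only [Subtype.ext_iff, mul_ite, mul_zero, mul_comm]
  simp [this]

theorem sum_abs_le_norm_sum_haarCharge {d : ℕ} (K : DyadicNumbering (d + 1)) (n : ℕ)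
    (a : Fin (2 ^ (n * (d + 1))) → TypeNumber (d + 1) → ℝ) (r : TypeNumber (d + 1)) :
    ∑ k, |a k r| ≤ ‖∑ k, ∑ r, a k r • haarCharge K n k r‖ *
      ((2 : ℝ) ^ ((n : ℝ) * (d + 1 : ℕ) / 2) * 2 ^ n * (1 + 4 * (d + 1))) := by
  obtain ⟨m, hm, hlt, hinj, -⟩ := exists_corners K n
  choose χ hχ hχn using fun k l => exists_indicator_dyadicBox (hlt k l)
  rw [← Submodule.norm_coe]
  set α : StrongDual ℝ (BV (d + 1)) := ↑(∑ k, ∑ r, a k r • haarCharge K n k r) with hα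
  set P := (2 : ℝ) ^ ((n : ℝ) * (d + 1 : ℕ) / 2) with hP
  have hP0 : 0 < P := by positivity
  -- One `P` comes from the Haar functions and one from the test function; the product cancels the
  -- volume of a subcube up to the factor `2 ^ (d + 1)` that row orthogonality supplies.
  have hPP : P * P = (2 ^ n) ^ (d + 1) := by
    rw [hP, ← Real.rpow_add two_pos, ← pow_mul, ← Real.rpow_natCast]
    congr 1
    push_cast
    ring
  set s : ℝ := (2 ^ (n + 1))⁻¹ with hs
  have hs0 : 0 < s := by positivity
  have hαχ : ∀ k l, α (χ k l) =
      P * ((∑ r, a k r * haarMatrix (d + 1) r l) * s ^ (d + 1)) := by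
    intro k l
    have hint : ∀ k' l', ∫ x in child K k' l', (χ k l).toL1 x =
        if k' = k ∧ l' = l then s ^ (d + 1) else 0 := by
      intro k' l'
      rw [hm, setIntegral_congr_ae (g := (dyadicBox (n + 1) (m k l)).indicator fun _ => (1 : ℝ))
        (measurableSet_dyadicBox _) ((hχ k l).mono fun x hx _ => hx),
        setIntegral_indicator (measurableSet_dyadicBox _)]
      split_ifs with h
      · rw [h.1, h.2, inter_self]
        simp [measureReal_dyadicBox, hs]
      · have hne : m k' l' ≠ m k l := fun he => h (hinj _ _ _ _ he)
        simp [measureReal_def, volume_dyadicBox_inter hne]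
    rw [hα, sum_haarCharge_apply, ← hP]
    simp only [hint, ite_and, mul_ite, mul_zero]
    simp
  -- Up to null sets, this is the sum over `k` of the Haar functions of type `r`, weighted by the
  -- signs of `a k r`.
  set u : BV (d + 1) := ∑ k, ∑ l,
    (P * SignType.sign (a k r) * haarMatrix (d + 1) r l) • χ k l with hu
  have hαu : α u = ∑ k, |a k r| := by
    simp only [hu, map_sum, map_smul, hαχ, smul_eq_mul]
    refine Finset.sum_congr rfl fun k _ => ?_
    have hrow := sum_haarMatrix_mul_coeff (a k) r
    calc _ = P * P * s ^ (d + 1) * SignType.sign (a k r) * ∑ l, haarMatrix (d + 1) r l *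
          ∑ r', a k r' * haarMatrix (d + 1) r' l := by
          rw [Finset.mul_sum]
          refine Finset.sum_congr rfl fun l _ => ?_
          ring
      _ = (2 ^ n * s * 2) ^ (d + 1) * (SignType.sign (a k r) * a k r) := by
          rw [hrow, hPP]; ring_nf
      _ = |a k r| := by
          rw [sign_mul_self, hs]
          have : (2 : ℝ) ^ n * (2 ^ (n + 1))⁻¹ * 2 = 1 := by field_simp; ring
          rw [this, one_pow, one_mul]
  have hun : ‖u‖ ≤ P * 2 ^ n * (1 + 4 * (d + 1)) := by
    have hcoef : ∀ k l, ‖(P * SignType.sign (a k r) * haarMatrix (d + 1) r l) • χ k l‖ ≤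
        P * (s ^ (d + 1) + 2 * (d + 1) * s ^ d) := by
      intro k l
      rw [norm_smul, norm_mul, norm_mul, Real.norm_eq_abs, Real.norm_eq_abs, Real.norm_eq_abs,
        abs_of_pos hP0]
      have h1 : |((SignType.sign (a k r) : SignType) : ℝ)| ≤ 1 := by
        rcases SignType.sign (a k r) <;> simp
      have h2 := abs_haarMatrix_le (d + 1) r l
      refine mul_le_mul ?_ (hχn k l) (norm_nonneg _) hP0.le
      rw [mul_assoc]
      exact mul_le_of_le_one_right hP0.le (mul_le_one₀ h1 (abs_nonneg _) h2)
    -- There are `(2 ^ (n + 1)) ^ (d + 1)` subcubes: their volumes add up to `1`, while the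
    -- perimeter terms leave one factor `2 ^ (n + 1)`, the source of the loss `2 ^ n`.
    have hs1 : 2 ^ (n + 1) * s = 1 := mul_inv_cancel₀ (by positivity)
    calc ‖u‖ ≤ ∑ k, ∑ l, ‖(P * SignType.sign (a k r) * haarMatrix (d + 1) r l) • χ k l‖ :=
          (norm_sum_le _ _).trans (Finset.sum_le_sum fun k _ => norm_sum_le _ _)
      _ ≤ ∑ _k : Fin (2 ^ (n * (d + 1))), ∑ _l : Fin (2 ^ (d + 1)),
          P * (s ^ (d + 1) + 2 * (d + 1) * s ^ d) :=
          Finset.sum_le_sum fun k _ => Finset.sum_le_sum fun l _ => hcoef k l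
      _ = (2 ^ (n + 1)) ^ (d + 1) * (P * (s ^ (d + 1) + 2 * (d + 1) * s ^ d)) := by
          simp only [Finset.sum_const, Finset.card_univ, Fintype.card_fin, nsmul_eq_mul]
          push_cast
          ring
      _ = P * ((2 ^ (n + 1) * s) ^ (d + 1) +
          2 * (d + 1) * 2 ^ (n + 1) * (2 ^ (n + 1) * s) ^ d) := by ring_nf
      _ = P * (1 + 4 * (d + 1) * 2 ^ n) := by rw [hs1, one_pow, one_pow]; ring
      _ ≤ P * (2 ^ n + 4 * (d + 1) * 2 ^ n) := by
          gcongr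
          exact one_le_pow₀ one_le_two
      _ = _ := by ring
  calc ∑ k, |a k r| = α u := hαu.symm
    _ ≤ ‖α u‖ := le_abs_self _
    _ ≤ ‖α‖ * ‖u‖ := α.le_opNorm u
    _ ≤ _ := by gcongr

end StrongCharge

end

/-! ### Assembly of the two bounds -/

theorem mainTheorem11 (d : ℕ) (hd : 1 ≤ d) :
    ∃ C : ℝ, 0 < C ∧
      ∀ (K : StrongCharge.DyadicNumbering d) (n : ℕ)
        (a : Fin (2 ^ (n * d)) → StrongCharge.TypeNumber d → ℝ),
        1 / ((2 : ℝ) ^ ((n : ℝ) * ((d : ℝ) / 2 + 1)) * C) *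
            (⨆ r : StrongCharge.TypeNumber d, ∑ k, |a k r|)
          ≤ ‖∑ k, ∑ r, a k r • StrongCharge.haarCharge K n k r‖ ∧
        ‖∑ k, ∑ r, a k r • StrongCharge.haarCharge K n k r‖
          ≤ C * (2 : ℝ) ^ ((n : ℝ) * ((d : ℝ) / 2 - 1)) *
            (⨆ p : Fin (2 ^ (n * d)) × StrongCharge.TypeNumber d, |a p.1 p.2|) := by
  obtain ⟨e, rfl⟩ : ∃ e, d = e + 1 := ⟨d - 1, by omega⟩
  -- The sum of the constants of the upper and the lower bound serves for both.
  refine ⟨12 ^ (e + 1) * (e + 1 : ℕ) + (1 + 4 * (e + 1)), by positivity, fun K n a => ⟨?_, ?_⟩⟩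
  · have h2 : (2 : ℝ) ^ ((n : ℝ) * (((e + 1 : ℕ) : ℝ) / 2 + 1)) =
        (2 : ℝ) ^ ((n : ℝ) * (e + 1 : ℕ) / 2) * 2 ^ n := by
      rw [← Real.rpow_natCast 2 n, ← Real.rpow_add two_pos]
      congr 1
      ring
    rw [h2, one_div_mul_eq_div, div_le_iff₀ (by positivity)]
    refine Real.iSup_le (fun r => ?_) (by positivity)
    refine (StrongCharge.sum_abs_le_norm_sum_haarCharge K n a r).trans ?_
    refine mul_le_mul_of_nonneg_left ?_ (by positivity)
    refine mul_le_mul_of_nonneg_left ?_ (by positivity)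
    exact le_add_of_nonneg_left (by positivity)
  · have hM : 0 ≤ ⨆ p : Fin (2 ^ (n * (e + 1))) × StrongCharge.TypeNumber (e + 1),
        |a p.1 p.2| := Real.iSup_nonneg fun p => abs_nonneg _
    have h2 : (2 : ℝ) ^ ((n : ℝ) * (((e + 1 : ℕ) : ℝ) / 2 - 1)) =
        (2 : ℝ) ^ ((n : ℝ) * (e + 1 : ℕ) / 2) * (2 ^ n)⁻¹ := by
      rw [← Real.rpow_natCast 2 n, ← Real.rpow_neg two_pos.le, ← Real.rpow_add two_pos]
      congr 1
      ring
    rw [h2]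
    refine (StrongCharge.norm_sum_haarCharge_le K n a hM
      fun k r => le_ciSup (f := fun p : Fin (2 ^ (n * (e + 1))) × StrongCharge.TypeNumber (e + 1) =>
        |a p.1 p.2|) (Set.finite_range _).bddAbove (k, r)).trans ?_
    refine mul_le_mul_of_nonneg_right ?_ hM
    gcongr
    exact le_add_of_nonneg_right (by positivity)
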